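/- Let $k$ be a field and let $I=(f_1,f_2,f_3,f_4)\subset S=k[x,y,z]$ be the ideal generated by four general quadratic forms. Then the Hilbert(–Samuel) coefficients of $I$ are $(e_0,e_1,e_2,e_3)=(8,4,3,1)$; that is, for all large $s$, $$\ell(S/I^s)=8\binom{s+2}{3}-4\binom{s+1}{2}+3\binom{s}{1}-1 .$$ Here, for an ideal $I\subset S_n=k[x_1,\dots,x_n]$ with $S_n/I$ Artinian, the Hilbert coefficients $e_0,\dots,e_n$ of $I$ are the integers such that $\ell(S_n/I^s)=\sum_{i=0}^n(-1)^ie_i\binom{s+n-i-1}{n-i}$ for all large $s$. "General" means that there is a polynomial $P$ over $k$ in the $4\cdot 6=24$ coefficients of four quadratic forms, not vanishing at some quadruple of quadratic forms over $k$, such that the assertion holds for every quadruple with $P(f_1,f_2,f_3,f_4)\neq0$; moreover the same $P$ works for quadruples of quadratic forms over every extension field $K$ of $k$ (with $S=K[x,y,z]$). -/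

import Mathlib

/-- The exponent vectors of the monomials of degree two in `n` variables. -/
abbrev QuadMonomial (n : ℕ) : Type := {m : Fin n →₀ ℕ // m.degree = 2}

/-- The coefficients of an `r`-tuple of quadratic forms in `n` variables, that is, the
coordinates of the tuple as a point of the affine space with one coordinate for each pair
(index of a form, monomial of degree two). -/
def quadCoeffs {K : Type*} [CommSemiring K] {n r : ℕ} (f : Fin r → MvPolynomial (Fin n) K) :
    Fin r × QuadMonomial n → K :=
  fun p => (f p.1).coeff p.2.1

/-- `e₀, …, eₙ` are the Hilbert coefficients of the ideal `I` of `S = K[x₁, …, xₙ]`: for all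
large `s` the length of `S / I ^ s` is finite and equal to
`∑ i = 0, …, n, (-1) ^ i * e i * C(s + n - i - 1, n - i)`.
(The natural-number subtractions are honest for `s ≥ 1`.) -/
def IsHilbertCoefficients {K : Type*} [Field K] {n : ℕ} (I : Ideal (MvPolynomial (Fin n) K))
    (e : Fin (n + 1) → ℤ) : Prop :=
  ∀ᶠ s : ℕ in Filter.atTop, ∃ l : ℕ,
    Module.length (MvPolynomial (Fin n) K) (MvPolynomial (Fin n) K ⧸ I ^ s) = (l : ℕ∞) ∧
    (l : ℤ) = ∑ i : Fin (n + 1),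
      (-1) ^ (i : ℕ) * e i * (Nat.choose (s + n - (i : ℕ) - 1) (n - (i : ℕ)) : ℤ)

/-!
Let `W` be the span of the four forms `f` and `S_d` the space of forms of degree `d` in three
variables. For general `f` every cubic lies in the ideal of the forms, `S_1 W = S_3`. Hence
`S_1 W^s = S_{2s+1}`, so that `I^s` contains all forms of degree greater than `2s` and
`ℓ(S / I^s) = C(2s+3, 3) - dim W^s`.

The dimension of `W^s` is the Hilbert function of `K[f₀, …, f₃]`. Since `S_1 W = S_3`, the ring
`K[x, y, z]` is finite over this subalgebra, which therefore has dimension three, so the ideal of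
relations among the `f j` is a height-one prime of a factorial ring: it is generated by one form
`g`. If `f` satisfies no relation of degree three, then `deg g = 4`: the excess of
`dim K[T]_11 = 364` over `dim S_22 = 276` is `88`, but a form of degree at least five has at most
`C(9, 3) = 84` independent multiples in degree eleven. So `dim W^s = C(s+3, 3) - C(s-1, 3)`.

Both conditions on `f` bound from below the rank of a family depending polynomially on the
coefficients, so it suffices to find one example over each field. The forms
`yz, xz, xy, x² + y² + z²` parametrize Steiner's Roman surface, whose equation is an irreducible
quartic in every characteristic.
-/

open MvPolynomial

section HomogeneousParts

variable {σ R : Type*} [CommSemiring R]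

theorem homogeneousSubmodule_mul_homogeneousSubmodule (a b : ℕ) :
    homogeneousSubmodule σ R a * homogeneousSubmodule σ R b = homogeneousSubmodule σ R (a + b) := by
  rw [← homogeneousSubmodule_one_pow R a, ← homogeneousSubmodule_one_pow R b, ← pow_add,
    homogeneousSubmodule_one_pow]

variable [Nontrivial R]

theorem finrank_restrictSupport (s : Set (σ →₀ ℕ)) :
    Module.finrank R (restrictSupport R s) = s.ncard :=
  Module.finrank_eq_nat_card_basis (basisRestrictSupport R s)

variable [Fintype σ]

theorem ncard_degree_eq (d : ℕ) :
    {e : σ →₀ ℕ | e.degree = d}.ncard = (Fintype.card σ + d - 1).choose d := by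
  classical
  have : {e : σ →₀ ℕ | e.degree = d} = (Finset.univ : Finset σ).finsuppAntidiag d := by
    ext e
    simp [Finset.mem_finsuppAntidiag, Finsupp.degree_eq_sum]
  rw [this, Set.ncard_coe_finset, Finset.card_finsuppAntidiag_nat_eq_choose, Finset.card_univ]

theorem ncard_degree_le (n d : ℕ) :
    {e : Fin (n + 1) →₀ ℕ | e.degree ≤ d}.ncard = (d + n + 1).choose (n + 1) := by
  induction d with
  | zero => simp [Finsupp.degree_eq_zero_iff]
  | succ d ih =>
    have hunion : {e : Fin (n + 1) →₀ ℕ | e.degree ≤ d + 1} =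
        {e | e.degree ≤ d} ∪ {e | e.degree = d + 1} := by
      ext e
      exact Nat.le_succ_iff
    have hdisj : Disjoint {e : Fin (n + 1) →₀ ℕ | e.degree ≤ d} {e | e.degree = d + 1} :=
      Set.disjoint_left.2 fun e (he : e.degree ≤ d) (he' : e.degree = d + 1) => by lia
    rw [hunion, Set.ncard_union_eq hdisj (Finsupp.finite_of_degree_le d)
      ((Finsupp.finite_of_degree_le (d + 1)).subset fun e he => he.le), ih, ncard_degree_eq,
      Fintype.card_fin, show n + 1 + (d + 1) - 1 = n + (d + 1) by lia, Nat.choose_symm_add.symm,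
      show n + (d + 1) = d + n + 1 by lia, show d + 1 + n + 1 = d + n + 1 + 1 by lia,
      Nat.choose_succ_succ' (d + n + 1) n, add_comm]

theorem finrank_homogeneousSubmodule (d : ℕ) :
    Module.finrank R (homogeneousSubmodule σ R d) = (Fintype.card σ + d - 1).choose d := by
  rw [homogeneousSubmodule_eq_finsupp_supported, ← ncard_degree_eq]
  exact finrank_restrictSupport _

end HomogeneousParts

section GeneratedByForms

variable {σ R : Type*} [CommSemiring R] {n : ℕ} {W : Submodule R (MvPolynomial σ R)}

theorem homogeneousComponent_mul_mem (hW : W ≤ homogeneousSubmodule σ R n) {p : MvPolynomial σ R}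
    (hp : p ∈ W) (a : MvPolynomial σ R) : homogeneousComponent n (a * p) ∈ W := by
  induction a using MvPolynomial.induction_on' with
  | monomial e c =>
    rw [homogeneousComponent_of_mem ((isHomogeneous_monomial c rfl).mul (hW hp))]
    split_ifs with hn
    · obtain rfl : e = 0 := by rw [← Finsupp.degree_eq_zero_iff]; lia
      simpa [← C_apply, C_mul'] using W.smul_mem c hp
    · exact W.zero_mem
  | add a b ha hb => simpa only [add_mul, map_add] using add_mem ha hb

theorem homogeneousComponent_mem_of_mem_span (hW : W ≤ homogeneousSubmodule σ R n)
    {p : MvPolynomial σ R} (hp : p ∈ Ideal.span (W : Set (MvPolynomial σ R))) :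
    homogeneousComponent n p ∈ W := by
  suffices ∀ a, homogeneousComponent n (a * p) ∈ W by simpa using this 1
  induction hp using Submodule.span_induction with
  | mem p hp => exact homogeneousComponent_mul_mem hW hp
  | zero => simp
  | add p q _ _ hp hq => simpa only [mul_add, map_add] using fun a => add_mem (hp a) (hq a)
  | smul b p _ hp => simpa only [smul_eq_mul, mul_assoc] using fun a => hp (a * b)

open scoped Pointwise in
theorem ideal_span_pow_eq_span_pow {A : Type*} [CommSemiring A] [Algebra R A] (t : Set A) (s : ℕ) :
    Ideal.span t ^ s = Ideal.span (↑(Submodule.span R t ^ s) : Set A) := by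
  rw [Submodule.span_pow, Ideal.span, Submodule.span_pow]
  exact (Submodule.span_span_of_tower R A (t ^ s)).symm

theorem span_range_le_homogeneousSubmodule {ι : Type*} {f : ι → MvPolynomial σ R}
    (hf : ∀ j, (f j).IsHomogeneous n) :
    Submodule.span R (Set.range f) ≤ homogeneousSubmodule σ R n :=
  Submodule.span_le.2 (Set.range_subset_iff.2 hf)

theorem homogeneousSubmodule_one_mul_le (hW : W ≤ homogeneousSubmodule σ R n) :
    homogeneousSubmodule σ R 1 * W ≤ homogeneousSubmodule σ R (n + 1) := by
  rw [add_comm, ← homogeneousSubmodule_mul_homogeneousSubmodule]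
  exact mul_le_mul' le_rfl hW

theorem pow_le_homogeneousSubmodule (hW : W ≤ homogeneousSubmodule σ R n) (s : ℕ) :
    W ^ s ≤ homogeneousSubmodule σ R (n * s) := by
  induction s with
  | zero => simp [homogeneousSubmodule_zero]
  | succ s ih =>
    rw [pow_succ, mul_add_one, ← homogeneousSubmodule_mul_homogeneousSubmodule]
    exact mul_le_mul' ih hW

theorem homogeneousSubmodule_one_mul_pow
    (hW : homogeneousSubmodule σ R 1 * W = homogeneousSubmodule σ R (n + 1)) (s : ℕ) :
    homogeneousSubmodule σ R 1 * W ^ s = homogeneousSubmodule σ R (n * s + 1) := by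
  induction s with
  | zero => simp
  | succ s ih =>
    calc homogeneousSubmodule σ R 1 * W ^ (s + 1)
      _ = homogeneousSubmodule σ R (n * s + 1) * W := by rw [pow_succ, ← mul_assoc, ih]
      _ = homogeneousSubmodule σ R (n * s) * (homogeneousSubmodule σ R 1 * W) := by
        rw [← mul_assoc, homogeneousSubmodule_mul_homogeneousSubmodule]
      _ = homogeneousSubmodule σ R (n * (s + 1) + 1) := by
        rw [hW, homogeneousSubmodule_mul_homogeneousSubmodule]; rfl

theorem pow_idealOfVars_eq_span_homogeneousSubmodule (d : ℕ) :
    idealOfVars σ R ^ d = Ideal.span (homogeneousSubmodule σ R d : Set (MvPolynomial σ R)) := by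
  rw [idealOfVars, ideal_span_pow_eq_span_pow (R := R), ← homogeneousSubmodule_one_eq_span_X,
    homogeneousSubmodule_one_pow]

theorem pow_idealOfVars_le_span_pow
    (hW : homogeneousSubmodule σ R 1 * W = homogeneousSubmodule σ R (n + 1)) (s : ℕ) :
    idealOfVars σ R ^ (n * s + 1) ≤ Ideal.span (↑(W ^ s) : Set (MvPolynomial σ R)) := by
  rw [pow_idealOfVars_eq_span_homogeneousSubmodule, ← homogeneousSubmodule_one_mul_pow hW,
    Ideal.span_le]
  exact fun p hp => Submodule.mul_induction_on hp
    (fun a _ p hp => Ideal.mul_mem_left _ a (Ideal.subset_span hp)) fun p q hp hq => add_mem hp hq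

theorem homogeneousSubmodule_succ_mul
    (hW : homogeneousSubmodule σ R 1 * W = homogeneousSubmodule σ R (n + 1)) (e : ℕ) :
    homogeneousSubmodule σ R (e + 1) * W = homogeneousSubmodule σ R (e + 1 + n) := by
  rw [← homogeneousSubmodule_mul_homogeneousSubmodule, mul_assoc, hW,
    homogeneousSubmodule_mul_homogeneousSubmodule, add_assoc, add_comm 1]

theorem finite_adjoin_of_homogeneousSubmodule_mul_eq [Finite σ] {t : Set (MvPolynomial σ R)}
    {d : ℕ} (hd : 0 < d)
    (ht : homogeneousSubmodule σ R 1 * Submodule.span R t = homogeneousSubmodule σ R (d + 1)) :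
    Module.Finite (Algebra.adjoin R t) (MvPolynomial σ R) := by
  have hfin : {e : σ →₀ ℕ | e.degree ≤ d}.Finite := Finsupp.finite_of_degree_le d
  let N := Submodule.span (Algebra.adjoin R t) ((monomial · (1 : R)) '' {e : σ →₀ ℕ | e.degree ≤ d})
  suffices hN : ∀ n, homogeneousSubmodule σ R n ≤ N.restrictScalars R by
    have htop : N = ⊤ := eq_top_iff.2 fun p _ => by
      rw [← sum_homogeneousComponent p]
      exact sum_mem fun i _ => hN i (homogeneousComponent_mem i p)
    exact ⟨Submodule.fg_def.2 ⟨_, hfin.image _, htop⟩⟩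
  intro n
  induction n using Nat.strong_induction_on with
  | _ n ih =>
    rcases le_or_gt n d with hnd | hnd
    · calc homogeneousSubmodule σ R n
        _ = restrictSupport R {e | e.degree = n} := homogeneousSubmodule_eq_finsupp_supported ..
        _ ≤ restrictSupport R {e | e.degree ≤ d} :=
          restrictSupport_mono R fun e he => he.trans_le hnd
        _ ≤ N.restrictScalars R := by
          rw [restrictSupport_eq_span]
          exact Submodule.span_le_restrictScalars ..
    · obtain ⟨i, rfl⟩ : ∃ i, n = i + 1 + d := ⟨n - d - 1, by lia⟩
      rw [← homogeneousSubmodule_succ_mul ht, Submodule.mul_le]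
      intro p hp w hw
      rw [mul_comm]
      exact N.smul_mem ⟨w, Algebra.span_le_adjoin R t hw⟩ (ih (i + 1) (by lia) hp)

end GeneratedByForms

section QuotientDimension

variable {σ R : Type*} [CommRing R] {d : ℕ} {W : Submodule R (MvPolynomial σ R)}

theorem mem_homogeneousSubmodule_of_mem_pow_idealOfVars {p : MvPolynomial σ R}
    (hp : p ∈ idealOfVars σ R ^ d) (hd : p ∈ restrictSupport R {e | e.degree ≤ d}) :
    p ∈ homogeneousSubmodule σ R d := by
  rw [homogeneousSubmodule_eq_finsupp_supported]
  exact fun e he => le_antisymm (hd he) ((mem_pow_idealOfVars_iff d p).1 hp e he)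

theorem mem_span_iff_of_degree_le (hW : W ≤ homogeneousSubmodule σ R d)
    {p : MvPolynomial σ R} (hd : p ∈ restrictSupport R {e | e.degree ≤ d}) :
    p ∈ Ideal.span (W : Set (MvPolynomial σ R)) ↔ p ∈ W := by
  refine ⟨fun hp => ?_, fun hp => Ideal.subset_span hp⟩
  have hpow : p ∈ idealOfVars σ R ^ d := by
    rw [pow_idealOfVars_eq_span_homogeneousSubmodule]
    exact Ideal.span_mono hW hp
  rw [← homogeneousComponent_eq_self (mem_homogeneousSubmodule_of_mem_pow_idealOfVars hpow hd)]
  exact homogeneousComponent_mem_of_mem_span hW hp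

theorem exists_sub_mem_of_pow_idealOfVars_le {J : Ideal (MvPolynomial σ R)}
    (hJ : idealOfVars σ R ^ (d + 1) ≤ J) (p : MvPolynomial σ R) :
    ∃ q ∈ restrictSupport R {e : σ →₀ ℕ | e.degree ≤ d}, p - q ∈ J := by
  induction p using MvPolynomial.induction_on' with
  | monomial e c =>
    rcases le_or_gt e.degree d with he | he
    · exact ⟨monomial e c, (monomial_mem_restrictSupport R).2 (Or.inl he), by simp⟩
    · refine ⟨0, zero_mem _, hJ ((mem_pow_idealOfVars_iff _ _).2 fun e' he' => ?_)⟩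
      rw [sub_zero] at he'
      rwa [Finset.mem_singleton.1 (support_monomial_subset he')]
  | add p q hp hq =>
    obtain ⟨p', hp', hpJ⟩ := hp
    obtain ⟨q', hq', hqJ⟩ := hq
    exact ⟨p' + q', add_mem hp' hq', by simpa only [add_sub_add_comm] using add_mem hpJ hqJ⟩

theorem surjective_mk_domRestrict {J : Ideal (MvPolynomial σ R)}
    (hJ : idealOfVars σ R ^ (d + 1) ≤ J) :
    Function.Surjective ((Ideal.Quotient.mkₐ R J).toLinearMap.domRestrict
      (restrictSupport R {e : σ →₀ ℕ | e.degree ≤ d})) := fun a => by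
  obtain ⟨p, rfl⟩ := Ideal.Quotient.mk_surjective a
  obtain ⟨q, hq, hpq⟩ := exists_sub_mem_of_pow_idealOfVars_le hJ p
  exact ⟨⟨q, hq⟩, (Ideal.Quotient.eq.2 hpq).symm⟩

theorem finite_restrictSupport_degree_le [Finite σ] (d : ℕ) :
    Module.Finite R (restrictSupport R {e : σ →₀ ℕ | e.degree ≤ d}) :=
  have : Finite {e : σ →₀ ℕ | e.degree ≤ d} := Finsupp.finite_of_degree_le d
  Module.Finite.of_basis (basisRestrictSupport R _)

theorem finite_quotient_of_pow_idealOfVars_le [Finite σ] {J : Ideal (MvPolynomial σ R)}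
    (hJ : idealOfVars σ R ^ d ≤ J) : Module.Finite R (MvPolynomial σ R ⧸ J) :=
  have := finite_restrictSupport_degree_le (σ := σ) (R := R) d
  Module.Finite.of_surjective _
    (surjective_mk_domRestrict ((Ideal.pow_le_pow_right d.le_succ).trans hJ))

theorem finrank_quotient_span_add_finrank {K : Type*} [Field K] [Finite σ]
    {W : Submodule K (MvPolynomial σ K)} (hW : W ≤ homogeneousSubmodule σ K d)
    (hpow : idealOfVars σ K ^ (d + 1) ≤ Ideal.span (W : Set (MvPolynomial σ K))) :
    Module.finrank K (MvPolynomial σ K ⧸ Ideal.span (W : Set (MvPolynomial σ K))) +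
      Module.finrank K W = {e : σ →₀ ℕ | e.degree ≤ d}.ncard := by
  set J := Ideal.span (W : Set (MvPolynomial σ K))
  have := finite_restrictSupport_degree_le (σ := σ) (R := K) d
  set π := (Ideal.Quotient.mkₐ K J).toLinearMap.domRestrict
    (restrictSupport K {e : σ →₀ ℕ | e.degree ≤ d})
  have hker : π.ker = W.submoduleOf _ := by
    ext ⟨p, hp⟩
    exact Ideal.Quotient.eq_zero_iff_mem.trans (mem_span_iff_of_degree_le hW hp)
  have hle : W ≤ restrictSupport K {e : σ →₀ ℕ | e.degree ≤ d} := by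
    rw [homogeneousSubmodule_eq_finsupp_supported] at hW
    exact hW.trans (restrictSupport_mono K fun e he => he.le)
  rw [← finrank_restrictSupport (R := K), ← π.finrank_range_add_finrank_ker,
    LinearMap.range_eq_top.2 (surjective_mk_domRestrict hpow), finrank_top, hker,
    (Submodule.submoduleOfEquivOfLe hle).finrank_eq]

end QuotientDimension

section Length

variable {K : Type*} [Field K]

theorem isLocalRing_of_forall_sub_mem_nilradical {A : Type*} [CommRing A] [Algebra K A]
    [Nontrivial A] (h : ∀ a : A, ∃ c : K, a - algebraMap K A c ∈ nilradical A) :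
    IsLocalRing A := by
  refine IsLocalRing.of_isUnit_or_isUnit_one_sub_self fun a => ?_
  obtain ⟨c, hc⟩ := h a
  rcases eq_or_ne c 0 with rfl | hc0
  · rw [map_zero, sub_zero] at hc
    exact Or.inr (IsNilpotent.isUnit_one_sub hc)
  · have hunit := IsNilpotent.isUnit_add_left_of_commute (mem_nilradical.1 hc)
      ((isUnit_iff_ne_zero.2 hc0).map (algebraMap K A)) (Commute.all _ _)
    exact Or.inl (by simpa using hunit)

theorem length_self_eq_finrank {A : Type*} [CommRing A] [Algebra K A]
    [Module.Finite K A] (h : ∀ a : A, ∃ c : K, a - algebraMap K A c ∈ nilradical A) :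
    Module.length A A = Module.finrank K A := by
  rcases subsingleton_or_nontrivial A with _ | _
  · simp [Module.length_eq_zero, Module.finrank_zero_of_subsingleton]
  have := isLocalRing_of_forall_sub_mem_nilradical h
  have : IsLocalHom (algebraMap K A) := inferInstance
  have hsurj : Function.Surjective
      (algebraMap (IsLocalRing.ResidueField K) (IsLocalRing.ResidueField A)) := fun r => by
    obtain ⟨a, rfl⟩ := IsLocalRing.residue_surjective r
    obtain ⟨c, hc⟩ := h a
    refine ⟨IsLocalRing.residue K c, (sub_eq_zero.1 ?_).symm⟩
    rw [IsLocalRing.ResidueField.algebraMap_residue, ← map_sub, IsLocalRing.residue_eq_zero_iff]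
    exact nilradical_le_prime _ hc
  rw [← Module.length_eq_finrank, IsLocalRing.length_restrictScalars K A A,
    Module.length_eq_of_surjective (M := IsLocalRing.ResidueField A) hsurj,
    Module.length_eq_one (IsLocalRing.ResidueField A) (IsLocalRing.ResidueField A), mul_one]

theorem length_quotient_eq_finrank {σ : Type*} [Finite σ] {J : Ideal (MvPolynomial σ K)} {d : ℕ}
    (hJ : idealOfVars σ K ^ d ≤ J) :
    Module.length (MvPolynomial σ K) (MvPolynomial σ K ⧸ J) =
      Module.finrank K (MvPolynomial σ K ⧸ J) := by
  have := finite_quotient_of_pow_idealOfVars_le hJ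
  rw [Module.length_eq_of_surjective (R := MvPolynomial σ K ⧸ J) Ideal.Quotient.mk_surjective]
  refine length_self_eq_finrank fun a => ?_
  obtain ⟨p, rfl⟩ := Ideal.Quotient.mk_surjective a
  have hp : p - C (constantCoeff p) ∈ idealOfVars σ K := by
    rw [← pow_one (idealOfVars σ K), mem_pow_idealOfVars_iff']
    intro e he
    obtain rfl := (Finsupp.degree_eq_zero_iff e).1 (Nat.lt_one_iff.1 he)
    simp [constantCoeff_eq]
  refine ⟨constantCoeff p, d, ?_⟩
  change (Ideal.Quotient.mk J (p - C (constantCoeff p))) ^ d = 0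
  rw [← map_pow, Ideal.Quotient.eq_zero_iff_mem]
  exact hJ (Ideal.pow_mem_pow hp d)

end Length

section KrullDimension

theorem ringKrullDim_le_of_isIntegral (A B : Type*) [CommRing A] [CommRing B] [Algebra A B]
    [Algebra.IsIntegral A B] : ringKrullDim B ≤ ringKrullDim A :=
  Order.krullDim_le_of_strictMono (PrimeSpectrum.comap (algebraMap A B)) fun _ _ h =>
    Ideal.IsIntegral.comap_lt_comap h

theorem height_add_ringKrullDim_quotient_le {A : Type*} [CommRing A] (P : Ideal A) [P.IsPrime] :
    P.height + ringKrullDim (A ⧸ P) ≤ ringKrullDim A := by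
  let x : PrimeSpectrum A := ⟨P, inferInstance⟩
  have hIci : PrimeSpectrum.zeroLocus (P : Set A) = Set.Ici x := rfl
  have : Nonempty (PrimeSpectrum A) := ⟨x⟩
  rw [ringKrullDim_quotient, hIci, ← Order.coheight_eq_krullDim_Ici,
    show P.height = _ from x.height_eq_orderHeight, ringKrullDim,
    Order.krullDim_eq_iSup_height_add_coheight_of_nonempty, ← WithBot.coe_add]
  exact WithBot.coe_le_coe.2 (le_iSup (fun y => Order.height y + Order.coheight y) x)

theorem isPrincipal_of_le_ringKrullDim_quotient {A : Type*} [CommRing A] [IsDomain A]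
    [UniqueFactorizationMonoid A] {n : ℕ} (hA : ringKrullDim A = n + 1) (P : Ideal A) [P.IsPrime]
    (hP : n ≤ ringKrullDim (A ⧸ P)) : P.IsPrincipal := by
  rcases eq_or_ne P ⊥ with rfl | hbot
  · exact bot_isPrincipal
  have hle : (P.height : WithBot ℕ∞) + n ≤ 1 + n :=
    calc (P.height : WithBot ℕ∞) + n
      _ ≤ P.height + ringKrullDim (A ⧸ P) := by gcongr
      _ ≤ ringKrullDim A := height_add_ringKrullDim_quotient_le P
      _ = 1 + n := by rw [hA, add_comm]
  have hheight : P.height ≤ 1 :=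
    WithBot.coe_le_coe.1 (ENat.WithBot.add_le_add_natCast_right_iff.1 hle)
  refine UniqueFactorizationMonoid.isPrincipal_of_height_eq_one (hheight.antisymm ?_)
  rwa [Order.one_le_iff_pos, pos_iff_ne_zero, Ne, Ideal.height_eq_zero_iff_eq_bot]

theorem isPrincipal_ker_of_isIntegral {R A B : Type*} [CommRing R] [CommRing A] [IsDomain A]
    [UniqueFactorizationMonoid A] [CommRing B] [IsDomain B] [Algebra R A] [Algebra R B]
    (φ : A →ₐ[R] B) [Algebra.IsIntegral φ.range B] {n : ℕ} (hA : ringKrullDim A = n + 1)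
    (hB : n ≤ ringKrullDim B) : (RingHom.ker φ).IsPrincipal := by
  have : (RingHom.ker φ).IsPrime := RingHom.ker_isPrime φ
  refine isPrincipal_of_le_ringKrullDim_quotient hA _ ?_
  rw [ringKrullDim_eq_of_ringEquiv (Ideal.quotientKerEquivRange φ).toRingEquiv]
  exact hB.trans (ringKrullDim_le_of_isIntegral _ B)

end KrullDimension

section GradedKernel

variable {σ ι R : Type*}

theorem homogeneousComponent_add_mul [CommSemiring R] {g : MvPolynomial σ R} {m : ℕ}
    (hg : g.IsHomogeneous m) (n : ℕ) (p : MvPolynomial σ R) :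
    homogeneousComponent (m + n) (g * p) = g * homogeneousComponent n p := by
  induction p using MvPolynomial.induction_on' with
  | monomial e c =>
    have he := isHomogeneous_monomial c (rfl : e.degree = e.degree)
    rw [homogeneousComponent_of_mem he, homogeneousComponent_of_mem (hg.mul he), mul_ite, mul_zero]
    simp only [add_right_inj]
  | add p q hp hq => simp only [mul_add, map_add, hp, hq]

theorem homogeneousComponent_aeval [CommSemiring R] {f : ι → MvPolynomial σ R} {d : ℕ} (hd : 0 < d)
    (hf : ∀ j, (f j).IsHomogeneous d) (e : ℕ) (p : MvPolynomial ι R) :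
    homogeneousComponent (d * e) (aeval f p) = aeval f (homogeneousComponent e p) := by
  induction p using MvPolynomial.induction_on' with
  | monomial m c =>
    have hm := isHomogeneous_monomial c (rfl : m.degree = m.degree)
    rw [homogeneousComponent_of_mem hm, homogeneousComponent_of_mem (hm.aeval f hf)]
    simp only [Nat.mul_right_inj hd.ne']
    split_ifs <;> simp
  | add p q hp hq => simp only [map_add, hp, hq]

theorem homogeneousComponent_mem_ker_aeval [CommRing R] {f : ι → MvPolynomial σ R} {d : ℕ}
    (hd : 0 < d) (hf : ∀ j, (f j).IsHomogeneous d) {p : MvPolynomial ι R}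
    (hp : p ∈ RingHom.ker (aeval (R := R) f)) (e : ℕ) :
    homogeneousComponent e p ∈ RingHom.ker (aeval (R := R) f) := by
  rw [RingHom.mem_ker] at hp ⊢
  rw [← homogeneousComponent_aeval hd hf, hp, map_zero]

theorem isHomogeneous_of_homogeneousComponent_mem_span [CommRing R] [IsDomain R]
    {g : MvPolynomial ι R} (hg : ∀ e, homogeneousComponent e g ∈ Ideal.span {g}) :
    g.IsHomogeneous g.totalDegree := by
  intro e he
  suffices h : e.degree = g.totalDegree by rwa [Finsupp.degree_eq_weight_one] at h
  have hne : homogeneousComponent e.degree g ≠ 0 := fun h => he <| by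
    simpa [coeff_homogeneousComponent] using congr_arg (coeff e) h
  refine (le_totalDegree (mem_support_iff.2 he)).antisymm ?_
  calc g.totalDegree
    _ ≤ (homogeneousComponent e.degree g).totalDegree :=
      totalDegree_le_of_dvd_of_isDomain (Ideal.mem_span_singleton.1 (hg _)) hne
    _ ≤ e.degree := (homogeneousComponent_isHomogeneous _ g).totalDegree_le

theorem span_singleton_inf_homogeneousSubmodule [CommRing R] {g : MvPolynomial ι R} {m : ℕ}
    (hg : g.IsHomogeneous m) (n : ℕ) :
    homogeneousSubmodule ι R (m + n) ⊓ (Ideal.span {g}).restrictScalars R =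
      (homogeneousSubmodule ι R n).map (LinearMap.mulLeft R g) := by
  ext p
  constructor
  · rintro ⟨hp, hgp⟩
    obtain ⟨q, rfl⟩ := Ideal.mem_span_singleton.1 hgp
    refine ⟨homogeneousComponent n q, homogeneousComponent_mem n q, ?_⟩
    rw [LinearMap.mulLeft_apply, ← homogeneousComponent_add_mul hg, homogeneousComponent_eq_self hp]
  · rintro ⟨q, hq, rfl⟩
    exact ⟨hg.mul hq, Ideal.mul_mem_right _ _ (Ideal.mem_span_singleton_self g)⟩

theorem finrank_span_singleton_inf_homogeneousSubmodule [CommRing R] [IsDomain R] [Fintype ι]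
    {g : MvPolynomial ι R} {m : ℕ} (hg : g.IsHomogeneous m) (hg0 : g ≠ 0) (n : ℕ) :
    Module.finrank R ↥(homogeneousSubmodule ι R (m + n) ⊓ (Ideal.span {g}).restrictScalars R) =
      (Fintype.card ι + n - 1).choose n := by
  rw [span_singleton_inf_homogeneousSubmodule hg, ← finrank_homogeneousSubmodule (R := R)]
  exact ((homogeneousSubmodule ι R n).equivMapOfInjective _
    (mul_right_injective₀ hg0)).finrank_eq.symm

theorem homogeneousSubmodule_inf_span_singleton_eq_bot [CommRing R] [IsDomain R]
    {g : MvPolynomial ι R} {m n : ℕ} (hg : g.IsHomogeneous m) (hn : n < m) :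
    homogeneousSubmodule ι R n ⊓ (Ideal.span {g}).restrictScalars R = ⊥ := by
  rw [eq_bot_iff]
  rintro p ⟨hp, hgp⟩
  by_contra hp0
  have hdvd : g ∣ p := Ideal.mem_span_singleton.1 hgp
  have hle := totalDegree_le_of_dvd_of_isDomain hdvd hp0
  rw [hg.totalDegree (ne_zero_of_dvd_ne_zero hp0 hdvd), IsHomogeneous.totalDegree hp hp0] at hle
  exact hle.not_gt hn

theorem span_pow_eq_map_homogeneousSubmodule [CommSemiring R] (f : ι → MvPolynomial σ R) (s : ℕ) :
    Submodule.span R (Set.range f) ^ s =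
      (homogeneousSubmodule ι R s).map (aeval f).toLinearMap := by
  rw [← homogeneousSubmodule_one_pow, Submodule.map_pow, homogeneousSubmodule_one_eq_span_X,
    Submodule.map_span, ← Set.range_comp]
  simp [Function.comp_def]

variable {K : Type*} [Field K]

theorem exists_isHomogeneous_ker_aeval_eq_span [Finite ι] [Finite σ]
    (hcard : Nat.card ι = Nat.card σ + 1) {f : ι → MvPolynomial σ K} {d : ℕ} (hd : 0 < d)
    (hf : ∀ j, (f j).IsHomogeneous d)
    (hspan : homogeneousSubmodule σ K 1 * Submodule.span K (Set.range f) =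
      homogeneousSubmodule σ K (d + 1)) :
    ∃ g : MvPolynomial ι K, g.IsHomogeneous g.totalDegree ∧
      RingHom.ker (aeval f) = Ideal.span {g} := by
  have hfinite := finite_adjoin_of_homogeneousSubmodule_mul_eq hd hspan
  rw [Algebra.adjoin_range_eq_range_aeval] at hfinite
  obtain ⟨g, hg⟩ := isPrincipal_ker_of_isIntegral (aeval (R := K) f) (n := Nat.card σ)
    (by simp [hcard]) (by simp)
  refine ⟨g, isHomogeneous_of_homogeneousComponent_mem_span fun e => ?_, hg⟩
  rw [← Ideal.submodule_span_eq, ← hg]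
  exact homogeneousComponent_mem_ker_aeval hd hf (hg ▸ Submodule.mem_span_singleton_self g) e

theorem finrank_map_add_finrank_inf_ker {V V' : Type*} [AddCommGroup V] [Module K V]
    [AddCommGroup V'] [Module K V'] (φ : V →ₗ[K] V') (p : Submodule K V) [Module.Finite K p] :
    Module.finrank K (p.map φ) + Module.finrank K ↥(p ⊓ φ.ker) = Module.finrank K p := by
  rw [← (φ.domRestrict p).finrank_range_add_finrank_ker, LinearMap.range_domRestrict,
    LinearMap.ker_domRestrict, ← Submodule.map_comap_subtype, Submodule.finrank_map_subtype_eq]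

theorem finrank_span_pow_add_finrank_inf_ker [Fintype ι] (f : ι → MvPolynomial σ K) (s : ℕ) :
    Module.finrank K ↥(Submodule.span K (Set.range f) ^ s) +
      Module.finrank K ↥(homogeneousSubmodule ι K s ⊓
        (RingHom.ker (aeval (R := K) f)).restrictScalars K) =
      (Fintype.card ι + s - 1).choose s := by
  have : Module.Finite K (homogeneousSubmodule ι K s) := .of_fg (homogeneousSubmodule_fg _ _ s)
  rw [span_pow_eq_map_homogeneousSubmodule, ← finrank_homogeneousSubmodule (R := K)]
  exact finrank_map_add_finrank_inf_ker (aeval f).toLinearMap (homogeneousSubmodule ι K s)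

end GradedKernel

section GeneralQuadruple

theorem six_mul_choose_three (n : ℕ) : 6 * (n + 2).choose 3 = (n + 2) * (n + 1) * n := by
  rw [← show Nat.factorial 3 = 6 from rfl, ← Nat.descFactorial_eq_factorial_mul_choose]
  change n * ((n + 1) * ((n + 2) * 1)) = _
  ring

theorem eq_alternating_sum_choose {l s : ℕ} (hs : 4 ≤ s)
    (hl : l + (s + 3).choose 3 = (2 * s + 3).choose 3 + (s - 1).choose 3) :
    (l : ℤ) = ∑ i : Fin 4, (-1) ^ (i : ℕ) * (![8, 4, 3, 1] : Fin 4 → ℤ) i *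
      ((s + 3 - (i : ℕ) - 1).choose (3 - (i : ℕ)) : ℤ) := by
  obtain ⟨t, rfl⟩ := Nat.exists_eq_add_of_le' hs
  have h1 := six_mul_choose_three (t + 5)
  have h2 := six_mul_choose_three (2 * t + 9)
  have h3 := six_mul_choose_three (t + 1)
  have h4 := six_mul_choose_three (t + 4)
  have h5 : 2 * (t + 5).choose 2 = (t + 5) * (t + 4) := by
    rw [mul_comm, Nat.choose_two_right, Nat.div_mul_cancel (Nat.even_mul_pred_self _).two_dvd]
    rfl
  rw [show t + 4 + 3 = t + 5 + 2 by lia, show 2 * (t + 4) + 3 = 2 * t + 9 + 2 by lia,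
    show t + 4 - 1 = t + 1 + 2 by lia] at hl
  zify at h1 h2 h3 h4 h5 hl
  simp only [Fin.sum_univ_four, Matrix.cons_val, Fin.val_zero, Fin.val_one, Fin.val_two,
    show ((3 : Fin 4) : ℕ) = 3 from rfl, show t + 4 + 3 - 1 - 1 = t + 5 by lia,
    show t + 4 + 3 - 2 - 1 = t + 4 by lia, Nat.sub_zero, Nat.sub_self, Nat.reduceSub,
    Nat.choose_one_right, Nat.choose_zero_right]
  push_cast
  linarith

variable {K : Type*} [Field K] {f : Fin 4 → MvPolynomial (Fin 3) K}

/-- The open conditions on four ternary quadratic forms `f` that determine the Hilbert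
coefficients: the ideal of the forms contains all cubic forms, and the forms satisfy no cubic
relation. Both are stated as lower bounds for a dimension, to make the openness visible; `10` and
`20` are the numbers of cubic monomials in three and in four variables. -/
structure IsGeneralQuadruple (f : Fin 4 → MvPolynomial (Fin 3) K) : Prop where
  isHomogeneous (j : Fin 4) : (f j).IsHomogeneous 2
  ten_le_finrank : 10 ≤ Module.finrank K
    ↥(homogeneousSubmodule (Fin 3) K 1 * Submodule.span K (Set.range f))
  twenty_le_finrank : 20 ≤ Module.finrank K ↥(Submodule.span K (Set.range f) ^ 3)

namespace IsGeneralQuadruple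

theorem span_le (hf : IsGeneralQuadruple f) :
    Submodule.span K (Set.range f) ≤ homogeneousSubmodule (Fin 3) K 2 :=
  span_range_le_homogeneousSubmodule hf.isHomogeneous

theorem homogeneousSubmodule_one_mul_span (hf : IsGeneralQuadruple f) :
    homogeneousSubmodule (Fin 3) K 1 * Submodule.span K (Set.range f) =
      homogeneousSubmodule (Fin 3) K 3 := by
  have : Module.Finite K (homogeneousSubmodule (Fin 3) K 3) :=
    .of_fg (homogeneousSubmodule_fg _ _ 3)
  refine Submodule.eq_of_le_of_finrank_le (homogeneousSubmodule_one_mul_le hf.span_le) ?_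
  rw [finrank_homogeneousSubmodule]
  exact hf.ten_le_finrank

theorem finrank_inf_ker_three (hf : IsGeneralQuadruple f) :
    Module.finrank K ↥(homogeneousSubmodule (Fin 4) K 3 ⊓
      (RingHom.ker (aeval (R := K) f)).restrictScalars K) = 0 := by
  have hsum := finrank_span_pow_add_finrank_inf_ker f 3
  have hle := hf.twenty_le_finrank
  norm_num [Nat.choose] at hsum
  lia

theorem le_finrank_inf_ker_eleven (hf : IsGeneralQuadruple f) :
    88 ≤ Module.finrank K ↥(homogeneousSubmodule (Fin 4) K 11 ⊓
      (RingHom.ker (aeval (R := K) f)).restrictScalars K) := by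
  have : Module.Finite K (homogeneousSubmodule (Fin 3) K 22) :=
    .of_fg (homogeneousSubmodule_fg _ _ 22)
  have hle := Submodule.finrank_mono (pow_le_homogeneousSubmodule hf.span_le 11)
  have hsum := finrank_span_pow_add_finrank_inf_ker f 11
  rw [finrank_homogeneousSubmodule] at hle
  norm_num [Nat.choose] at hle hsum
  lia

theorem exists_ker_aeval_eq_span (hf : IsGeneralQuadruple f) :
    ∃ g : MvPolynomial (Fin 4) K, g ≠ 0 ∧ g.IsHomogeneous 4 ∧
      RingHom.ker (aeval (R := K) f) = Ideal.span {g} := by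
  obtain ⟨g, hg, hker⟩ := exists_isHomogeneous_ker_aeval_eq_span (by simp) two_pos hf.isHomogeneous
    hf.homogeneousSubmodule_one_mul_span
  have hthree := hf.finrank_inf_ker_three
  have heleven := hf.le_finrank_inf_ker_eleven
  rw [hker] at hthree heleven
  have hle {m : ℕ} (hm : g.IsHomogeneous m) : m ≤ 11 := by
    by_contra! hlt
    rw [homogeneousSubmodule_inf_span_singleton_eq_bot hm hlt, finrank_bot] at heleven
    lia
  have hg0 : g ≠ 0 := by
    rintro rfl
    exact absurd (hle (isHomogeneous_zero (Fin 4) K 12)) (by lia)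
  have hfinrank := finrank_span_singleton_inf_homogeneousSubmodule hg hg0
  refine ⟨g, hg0, ?_, hker⟩
  suffices hdeg : g.totalDegree = 4 by rwa [hdeg] at hg
  obtain ⟨n, hn⟩ := Nat.exists_eq_add_of_le (hle hg)
  rw [hn, hfinrank, Fintype.card_fin] at heleven
  have hge : 4 ≤ g.totalDegree := by
    by_contra! hlt
    obtain ⟨m, hm⟩ := Nat.exists_eq_add_of_le (Nat.lt_succ_iff.1 hlt)
    rw [hm, hfinrank, Fintype.card_fin] at hthree
    exact (Nat.choose_pos (by lia)).ne' hthree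
  have hn7 : 7 ≤ n := by
    by_contra! hlt
    interval_cases n <;> simp +decide at heleven
  lia

theorem finrank_span_pow_add_choose (hf : IsGeneralQuadruple f) {s : ℕ} (hs : 4 ≤ s) :
    Module.finrank K ↥(Submodule.span K (Set.range f) ^ s) + (s - 1).choose 3 =
      (s + 3).choose 3 := by
  obtain ⟨g, hg0, hg, hker⟩ := hf.exists_ker_aeval_eq_span
  obtain ⟨n, rfl⟩ := Nat.exists_eq_add_of_le hs
  have hsum := finrank_span_pow_add_finrank_inf_ker f (4 + n)
  rw [hker, finrank_span_singleton_inf_homogeneousSubmodule hg hg0, Fintype.card_fin] at hsum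
  rw [show 4 + n - 1 = 3 + n by lia, show 4 + n + 3 = 3 + (4 + n) by lia, Nat.choose_symm_add,
    Nat.choose_symm_add]
  rwa [show 4 + n - 1 = 3 + n by lia, show 4 + (4 + n) - 1 = 3 + (4 + n) by lia] at hsum

theorem finrank_quotient_add_choose (hf : IsGeneralQuadruple f) {s : ℕ} (hs : 4 ≤ s) :
    Module.finrank K (MvPolynomial (Fin 3) K ⧸ Ideal.span (Set.range f) ^ s) + (s + 3).choose 3 =
      (2 * s + 3).choose 3 + (s - 1).choose 3 := by
  have hquotient := finrank_quotient_span_add_finrank (pow_le_homogeneousSubmodule hf.span_le s)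
    (pow_idealOfVars_le_span_pow hf.homogeneousSubmodule_one_mul_span s)
  rw [← ideal_span_pow_eq_span_pow, ncard_degree_le] at hquotient
  have hpow := hf.finrank_span_pow_add_choose hs
  lia

theorem isHilbertCoefficients (hf : IsGeneralQuadruple f) :
    IsHilbertCoefficients (Ideal.span (Set.range f)) ![8, 4, 3, 1] := by
  filter_upwards [Filter.eventually_ge_atTop 4] with s hs
  refine ⟨_, length_quotient_eq_finrank (d := 2 * s + 1) ?_,
    eq_alternating_sum_choose hs (hf.finrank_quotient_add_choose hs)⟩
  rw [ideal_span_pow_eq_span_pow (R := K) (Set.range f)]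
  exact pow_idealOfVars_le_span_pow hf.homogeneousSubmodule_one_mul_span s

end IsGeneralQuadruple

end GeneralQuadruple

section Specialization

variable {k τ κ : Type*} [Field k]

/-- The extension of a linear functional on polynomials over `k` to polynomials over a
`k`-algebra `A`; it acts on monomials through the algebra map. -/
noncomputable def extendFunctional (A : Type*) [CommSemiring A] [Algebra k A]
    (φ : MvPolynomial τ k →ₗ[k] k) : MvPolynomial τ A →ₗ[A] A :=
  (basisMonomials τ A).constr A fun e => algebraMap k A (φ (monomial e 1))

theorem extendFunctional_monomial (A : Type*) [CommSemiring A] [Algebra k A]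
    (φ : MvPolynomial τ k →ₗ[k] k) (e : τ →₀ ℕ) (a : A) :
    extendFunctional A φ (monomial e a) = a * algebraMap k A (φ (monomial e 1)) := by
  have h := (basisMonomials τ A).constr_basis A (fun e => algebraMap k A (φ (monomial e 1))) e
  rw [coe_basisMonomials] at h
  rw [extendFunctional, ← h, ← smul_eq_mul, ← map_smul, smul_monomial, smul_eq_mul, mul_one]

theorem extendFunctional_self (φ : MvPolynomial τ k →ₗ[k] k) : extendFunctional k φ = φ := by
  refine (basisMonomials τ k).ext fun e => ?_
  rw [coe_basisMonomials, extendFunctional_monomial, one_mul, Algebra.algebraMap_self_apply]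

theorem extendFunctional_map {A B : Type*} [CommSemiring A] [CommSemiring B] [Algebra k A]
    [Algebra k B] (φ : MvPolynomial τ k →ₗ[k] k) (g : A →ₐ[k] B) (p : MvPolynomial τ A) :
    extendFunctional B φ (map (g : A →+* B) p) = g (extendFunctional A φ p) := by
  induction p using MvPolynomial.induction_on' with
  | monomial e a => simp [extendFunctional_monomial]
  | add p q hp hq => simp only [map_add, hp, hq]

theorem exists_forall_linearIndependent_map_aeval [Finite κ] {σ : Type*}
    (v : κ → MvPolynomial τ (MvPolynomial σ k)) (c₀ : σ → k)
    (hv : LinearIndependent k fun i => map (aeval (R := k) c₀ : _ →+* k) (v i)) :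
    ∃ P : MvPolynomial σ k, aeval c₀ P ≠ 0 ∧
      ∀ (K : Type*) [Field K] [Algebra k K] (c : σ → K), aeval c P ≠ 0 →
        LinearIndependent K fun i => map (aeval (R := k) c : _ →+* K) (v i) := by
  classical
  have := Fintype.ofFinite κ
  obtain ⟨φ, hφ⟩ := LinearMap.exists_leftInverse_of_injective (Fintype.linearCombination k _)
    (LinearMap.ker_eq_bot.2 hv.fintypeLinearCombination_injective)
  have hφ_apply (a b : κ) : φ (map (aeval (R := k) c₀ : _ →+* k) (v a)) b =
      (1 : Matrix κ κ k) a b := by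
    simpa [Matrix.one_eq_pi_single, Pi.single_comm] using
      congr_fun (LinearMap.congr_fun hφ (Pi.single a 1)) b
  let M : Matrix κ κ (MvPolynomial σ k) :=
    .of fun a b => extendFunctional _ (LinearMap.proj b ∘ₗ φ) (v a)
  refine ⟨M.det, ?_, fun K _ _ c hc => ?_⟩
  · have hone : (aeval c₀).mapMatrix M = 1 := by
      ext a b
      change aeval c₀ (extendFunctional _ (LinearMap.proj b ∘ₗ φ) (v a)) = _
      rw [← hφ_apply, ← extendFunctional_map, extendFunctional_self]
      rfl
    rw [AlgHom.map_det, hone, Matrix.det_one]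
    exact one_ne_zero
  · rw [AlgHom.map_det] at hc
    refine .of_comp (LinearMap.pi fun b => extendFunctional K (LinearMap.proj b ∘ₗ φ)) ?_
    have hrow : (LinearMap.pi fun b => extendFunctional K (LinearMap.proj b ∘ₗ φ)) ∘
        (fun i => map (aeval (R := k) c : _ →+* K) (v i)) = ((aeval c).mapMatrix M).row :=
      funext₂ fun _ _ => extendFunctional_map _ _ _
    rw [hrow]
    exact Matrix.linearIndependent_rows_of_det_ne_zero hc

theorem exists_forall_finrank_span_le [Finite κ] {σ : Type*}
    (v : κ → MvPolynomial τ (MvPolynomial σ k)) (c₀ : σ → k) :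
    ∃ P : MvPolynomial σ k, aeval c₀ P ≠ 0 ∧
      ∀ (K : Type*) [Field K] [Algebra k K] (c : σ → K), aeval c P ≠ 0 →
        (Set.range fun i => map (aeval (R := k) c₀ : _ →+* k) (v i)).finrank k ≤
          (Set.range fun i => map (aeval (R := k) c : _ →+* K) (v i)).finrank K := by
  obtain ⟨κ', a, ha, hspan, hli⟩ := exists_linearIndependent' k
    fun i => map (aeval (R := k) c₀ : _ →+* k) (v i)
  have := Finite.of_injective a ha
  have := Fintype.ofFinite κ'
  obtain ⟨P, hP₀, hP⟩ := exists_forall_linearIndependent_map_aeval (v ∘ a) c₀ hli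
  refine ⟨P, hP₀, fun K _ _ c hc => ?_⟩
  rw [Set.finrank, Set.finrank, ← hspan, finrank_span_eq_card hli,
    ← finrank_span_eq_card (hP K c hc)]
  have := FiniteDimensional.span_of_finite K
    (Set.finite_range fun i => map (aeval (R := k) c : _ →+* K) (v i))
  exact Submodule.finrank_mono (Submodule.span_mono (Set.range_subset_iff.2 fun i => ⟨a i, rfl⟩))

end Specialization

section GenericForm

variable {n r : ℕ}

theorem finite_quadMonomial : Finite (QuadMonomial n) :=
  (Finsupp.finite_of_degree_le 2).subset fun _ he => le_of_eq he

/-- The quadratic forms whose coefficients are independent indeterminates. -/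
noncomputable def genericForm (k : Type*) [CommSemiring k] {n r : ℕ} (j : Fin r) :
    MvPolynomial (Fin n) (MvPolynomial (Fin r × QuadMonomial n) k) :=
  ∑ᶠ m : QuadMonomial n, monomial m.1 (X (j, m))

theorem map_genericForm {k K : Type*} [CommSemiring k] [CommSemiring K] [Algebra k K]
    {f : Fin r → MvPolynomial (Fin n) K}
    (hf : ∀ j, (f j).IsHomogeneous 2) (j : Fin r) :
    map (aeval (R := k) (quadCoeffs f) : _ →+* K) (genericForm k j) = f j := by
  have : Finite (QuadMonomial n) := finite_quadMonomial
  have := Fintype.ofFinite (QuadMonomial n)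
  rw [genericForm, finsum_eq_sum_of_fintype, map_sum]
  ext e
  simp only [map_monomial, RingHom.coe_coe, aeval_X, coeff_sum, coeff_monomial]
  by_cases he : e.degree = 2
  · rw [Finset.sum_eq_single ⟨e, he⟩ (fun m _ hm => if_neg fun h => hm (Subtype.ext h)) (by simp)]
    simp [quadCoeffs]
  · rw [(hf j).coeff_eq_zero he]
    exact Finset.sum_eq_zero fun m _ => if_neg fun h : m.1 = e => he (h ▸ m.2)

theorem span_range_mul_span_range {R A ι κ : Type*} [CommSemiring R] [Semiring A] [Algebra R A]
    (a : ι → A) (b : κ → A) :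
    Submodule.span R (Set.range a) * Submodule.span R (Set.range b) =
      Submodule.span R (Set.range fun p : ι × κ => a p.1 * b p.2) := by
  rw [Submodule.span_mul_span, ← Set.image2_mul, Set.image2_range]

theorem finrank_range_X_mul {R σ ι : Type*} [CommSemiring R] (f : ι → MvPolynomial σ R) :
    (Set.range fun p : σ × ι => X p.1 * f p.2).finrank R =
      Module.finrank R ↥(homogeneousSubmodule σ R 1 * Submodule.span R (Set.range f)) := by
  rw [homogeneousSubmodule_one_eq_span_X, span_range_mul_span_range, Set.finrank]

theorem finrank_range_mul_mul {R A ι : Type*} [CommSemiring R] [Semiring A] [Algebra R A]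
    (a : ι → A) :
    (Set.range fun p : (ι × ι) × ι => a p.1.1 * a p.1.2 * a p.2).finrank R =
      Module.finrank R ↥(Submodule.span R (Set.range a) ^ 3) := by
  rw [pow_three', span_range_mul_span_range, span_range_mul_span_range, Set.finrank]

theorem exists_forall_isGeneralQuadruple {k : Type*} [Field k]
    {f₀ : Fin 4 → MvPolynomial (Fin 3) k} (hf₀ : IsGeneralQuadruple f₀) :
    ∃ P : MvPolynomial (Fin 4 × QuadMonomial 3) k, aeval (quadCoeffs f₀) P ≠ 0 ∧
      ∀ (K : Type*) [Field K] [Algebra k K] (f : Fin 4 → MvPolynomial (Fin 3) K),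
        (∀ j, (f j).IsHomogeneous 2) → aeval (quadCoeffs f) P ≠ 0 → IsGeneralQuadruple f := by
  obtain ⟨P, hP₀, hP⟩ := exists_forall_finrank_span_le
    (fun p : Fin 3 × Fin 4 => X p.1 * genericForm k p.2) (quadCoeffs f₀)
  obtain ⟨Q, hQ₀, hQ⟩ := exists_forall_finrank_span_le
    (fun p : (Fin 4 × Fin 4) × Fin 4 =>
      genericForm k (n := 3) p.1.1 * genericForm k p.1.2 * genericForm k p.2) (quadCoeffs f₀)
  refine ⟨P * Q, by rw [map_mul]; exact mul_ne_zero hP₀ hQ₀, fun K _ _ f hf hPQ => ?_⟩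
  rw [map_mul] at hPQ
  have hlinear := hP K _ (left_ne_zero_of_mul hPQ)
  have hcubic := hQ K _ (right_ne_zero_of_mul hPQ)
  simp only [map_mul, map_X, map_genericForm hf₀.isHomogeneous, map_genericForm hf,
    finrank_range_X_mul, finrank_range_mul_mul] at hlinear hcubic
  exact ⟨hf, hf₀.ten_le_finrank.trans hlinear, hf₀.twenty_le_finrank.trans hcubic⟩

end GenericForm

section SteinerSurface

theorem homogeneousSubmodule_three_le_homogeneousSubmodule_one_mul {R σ : Type*} [CommRing R]
    [Fintype σ] {W : Submodule R (MvPolynomial σ R)} (hmul : ∀ i j, i ≠ j → X i * X j ∈ W)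
    (hsum : ∑ i, X i ^ 2 ∈ W) :
    homogeneousSubmodule σ R 3 ≤ homogeneousSubmodule σ R 1 * W := by
  classical
  have hX (i : σ) {p : MvPolynomial σ R} (hp : p ∈ W) : X i * p ∈ homogeneousSubmodule σ R 1 * W :=
    Submodule.mul_mem_mul (isHomogeneous_X R i) hp
  have hcube (i : σ) : X i * (X i * X i) ∈ homogeneousSubmodule σ R 1 * W := by
    have hsplit : X i * (X i * X i) =
        X i * ∑ j, X j ^ 2 - ∑ j ∈ Finset.univ.erase i, X j * (X j * X i : MvPolynomial σ R) := by
      rw [← Finset.add_sum_erase _ _ (Finset.mem_univ i), mul_add, Finset.mul_sum, add_sub_assoc,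
        ← Finset.sum_sub_distrib, Finset.sum_eq_zero fun j _ => by ring]
      ring
    rw [hsplit]
    exact sub_mem (hX i hsum)
      (sum_mem fun j hj => hX j (hmul j i (Finset.ne_of_mem_erase hj)))
  have hthree : homogeneousSubmodule σ R 3 =
      Submodule.span R (Set.range fun p : σ × σ × σ => X p.1 * (X p.2.1 * X p.2.2)) := by
    rw [← homogeneousSubmodule_one_pow, pow_three, homogeneousSubmodule_one_eq_span_X,
      span_range_mul_span_range, span_range_mul_span_range]
  rw [hthree, Submodule.span_le, Set.range_subset_iff]
  rintro ⟨i, j, l⟩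
  by_cases hjl : j = l
  · subst hjl
    by_cases hij : i = j
    · exact hij ▸ hcube i
    · rw [SetLike.mem_coe, mul_left_comm]
      exact hX j (hmul i j hij)
  · exact hX i (hmul j l hjl)

/-- The quadratic forms `yz, xz, xy, x² + y² + z²`, which parametrize Steiner's Roman surface. -/
noncomputable def steinerForms (R : Type*) [CommSemiring R] : Fin 4 → MvPolynomial (Fin 3) R :=
  ![X 1 * X 2, X 0 * X 2, X 0 * X 1, X 0 ^ 2 + X 1 ^ 2 + X 2 ^ 2]

/-- The equation of Steiner's Roman surface, the quartic relation between the `steinerForms`. -/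
noncomputable def steinerQuartic (R : Type*) [CommRing R] : MvPolynomial (Fin 4) R :=
  X 0 * X 1 * X 2 * X 3 + -(X 1 ^ 2 * X 2 ^ 2 + X 0 ^ 2 * X 2 ^ 2 + X 0 ^ 2 * X 1 ^ 2)

theorem steinerForms_isHomogeneous (R : Type*) [CommSemiring R] (j : Fin 4) :
    (steinerForms R j).IsHomogeneous 2 := by
  have hmul (i l : Fin 3) : (X i * X l : MvPolynomial (Fin 3) R).IsHomogeneous 2 :=
    (isHomogeneous_X R i).mul (isHomogeneous_X R l)
  have hsq (i : Fin 3) : (X i ^ 2 : MvPolynomial (Fin 3) R).IsHomogeneous 2 :=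
    isHomogeneous_X_pow i 2
  fin_cases j
  exacts [hmul 1 2, hmul 0 2, hmul 0 1, ((hsq 0).add (hsq 1)).add (hsq 2)]

theorem homogeneousSubmodule_three_le_mul_span_steinerForms (R : Type*) [CommRing R] :
    homogeneousSubmodule (Fin 3) R 3 ≤
      homogeneousSubmodule (Fin 3) R 1 * Submodule.span R (Set.range (steinerForms R)) := by
  have hmem (j : Fin 4) : steinerForms R j ∈ Submodule.span R (Set.range (steinerForms R)) :=
    Submodule.subset_span ⟨j, rfl⟩
  refine homogeneousSubmodule_three_le_homogeneousSubmodule_one_mul (fun i j hij => ?_) ?_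
  · wlog hlt : i < j generalizing i j
    · rw [mul_comm]
      exact this j i hij.symm (lt_of_le_of_ne (not_lt.1 hlt) hij.symm)
    fin_cases i <;> fin_cases j <;> first | contradiction | skip
    exacts [hmem 2, hmem 1, hmem 0]
  · rw [Fin.sum_univ_three]
    exact hmem 3

theorem steinerQuartic_isHomogeneous (R : Type*) [CommRing R] :
    (steinerQuartic R).IsHomogeneous 4 := by
  have hX := isHomogeneous_X (σ := Fin 4) R
  have hsq (i j : Fin 4) : (X i ^ 2 * X j ^ 2 : MvPolynomial (Fin 4) R).IsHomogeneous 4 :=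
    (isHomogeneous_X_pow i 2).mul (isHomogeneous_X_pow j 2)
  exact ((((hX 0).mul (hX 1)).mul (hX 2)).mul (hX 3)).add
    (((hsq 1 2).add (hsq 0 2)).add (hsq 0 1)).neg

theorem steinerQuartic_mem_ker_aeval (R : Type*) [CommRing R] :
    steinerQuartic R ∈ RingHom.ker (aeval (R := R) (steinerForms R)) := by
  simp only [RingHom.mem_ker, steinerQuartic, steinerForms, map_add, map_neg, map_mul, map_pow,
    aeval_X, Matrix.cons_val]
  ring

theorem irreducible_steinerQuartic (R : Type*) [CommRing R] [IsDomain R]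
    [UniqueFactorizationMonoid R] :
    Irreducible (steinerQuartic R) := by
  have hX {i : Fin 4} (hi : i ≠ 3) : (X i : MvPolynomial (Fin 4) R) ∈ supported R {3}ᶜ :=
    X_mem_supported.2 hi
  have hsq {i j : Fin 4} (hi : i ≠ 3) (hj : j ≠ 3) :
      (X i ^ 2 * X j ^ 2 : MvPolynomial (Fin 4) R) ∈ supported R {3}ᶜ :=
    mul_mem (pow_mem (hX hi) 2) (pow_mem (hX hj) 2)
  have hvars {p : MvPolynomial (Fin 4) R} (hp : p ∈ supported R {3}ᶜ) : 3 ∉ p.vars :=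
    fun h => mem_supported.1 hp h rfl
  have hrel {i : Fin 4} (hi : i ≠ 3) : IsRelPrime (X i : MvPolynomial (Fin 4) R)
      (-(X 1 ^ 2 * X 2 ^ 2 + X 0 ^ 2 * X 2 ^ 2 + X 0 ^ 2 * X 1 ^ 2)) := by
    rw [(X_prime (i := i)).irreducible.isRelPrime_iff_not_dvd]
    intro hdvd
    have := map_dvd (eval (Function.update 1 i 0)) hdvd
    fin_cases i <;> simp at this hi
  refine irreducible_mul_X_add _ _ 3 (by simp [X_ne_zero])
    (hvars (mul_mem (mul_mem (hX (by decide)) (hX (by decide))) (hX (by decide)))) (hvars ?_)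
    (((hrel (by decide)).mul_left (hrel (by decide))).mul_left (hrel (by decide)))
  exact neg_mem (add_mem (add_mem (hsq (by decide) (by decide)) (hsq (by decide) (by decide)))
    (hsq (by decide) (by decide)))

theorem homogeneousSubmodule_one_mul_span_steinerForms (R : Type*) [CommRing R] :
    homogeneousSubmodule (Fin 3) R 1 * Submodule.span R (Set.range (steinerForms R)) =
      homogeneousSubmodule (Fin 3) R 3 :=
  (homogeneousSubmodule_one_mul_le
    (span_range_le_homogeneousSubmodule (steinerForms_isHomogeneous R))).antisymm
    (homogeneousSubmodule_three_le_mul_span_steinerForms R)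

theorem ker_aeval_steinerForms (K : Type*) [Field K] :
    RingHom.ker (aeval (R := K) (steinerForms K)) = Ideal.span {steinerQuartic K} := by
  obtain ⟨g, -, hker⟩ := exists_isHomogeneous_ker_aeval_eq_span (by simp) two_pos
    (steinerForms_isHomogeneous K) (homogeneousSubmodule_one_mul_span_steinerForms K)
  have hdvd : g ∣ steinerQuartic K :=
    Ideal.mem_span_singleton.1 (hker ▸ steinerQuartic_mem_ker_aeval K)
  have hunit : ¬IsUnit g := fun hg => RingHom.ker_ne_top (aeval (R := K) (steinerForms K))
    (hker.trans (Ideal.span_singleton_eq_top.2 hg))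
  rw [hker, Ideal.span_singleton_eq_span_singleton]
  exact (((irreducible_steinerQuartic K).dvd_iff.1 hdvd).resolve_left hunit).symm

theorem isGeneralQuadruple_steinerForms (K : Type*) [Field K] :
    IsGeneralQuadruple (steinerForms K) where
  isHomogeneous := steinerForms_isHomogeneous K
  ten_le_finrank := by
    rw [homogeneousSubmodule_one_mul_span_steinerForms, finrank_homogeneousSubmodule]
    decide
  twenty_le_finrank := by
    have hsum := finrank_span_pow_add_finrank_inf_ker (steinerForms K) 3
    rw [ker_aeval_steinerForms, homogeneousSubmodule_inf_span_singleton_eq_bot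
      (steinerQuartic_isHomogeneous K) (by lia), finrank_bot] at hsum
    exact hsum.ge

end SteinerSurface

/-- The Hilbert coefficients of the ideal generated by four general quadratic forms in three
variables. "General" means: off the zero locus of a polynomial `P` in the coefficients of the
forms, where this locus does not contain all quadruples of quadratic forms over `k`. The same `P`
works for forms over any extension field `K` of `k`, in particular for `K = k`. -/
theorem mainTheorem4 (k : Type*) [Field k] :
    ∃ P : MvPolynomial (Fin 4 × QuadMonomial 3) k,
      (∃ f : Fin 4 → MvPolynomial (Fin 3) k,
        (∀ j, (f j).IsHomogeneous 2) ∧ MvPolynomial.aeval (quadCoeffs f) P ≠ 0) ∧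
      ∀ (K : Type*) [Field K] [Algebra k K] (f : Fin 4 → MvPolynomial (Fin 3) K),
        (∀ j, (f j).IsHomogeneous 2) →
        MvPolynomial.aeval (quadCoeffs f) P ≠ 0 →
        IsHilbertCoefficients (Ideal.span (Set.range f)) ![8, 4, 3, 1] := by
  obtain ⟨P, hP₀, hP⟩ := exists_forall_isGeneralQuadruple (isGeneralQuadruple_steinerForms k)
  exact ⟨P, ⟨steinerForms k, steinerForms_isHomogeneous k, hP₀⟩,
    fun K _ _ f hf hne => (hP K f hf hne).isHilbertCoefficients⟩
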